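/- Let $H$ be a complex Hilbert space of finite dimension $n$ and let $\{e_{ij}\}_{i,j=1}^n$ be a system of matrix units in the operators on $H$, that is, $e_{ij}e_{kl}=\delta_{jk}e_{il}$ and $\sum_{i=1}^n e_{ii}=1$. Let $\lambda_1,\dots,\lambda_n$ and $h_{ij}$ ($i,j=1,\dots,n$) be complex numbers and put \[ x=\sum_{i=1}^n\lambda_i e_{ii},\qquad h=\sum_{i,j=1}^n h_{ij}e_{ij}. \] Then the function $t\mapsto \operatorname{tr}\exp(x+th)$ of the real variable $t$ is infinitely differentiable, and for every integer $p\ge 1$ \[ \frac{d^p}{dt^p}\operatorname{tr}\exp(x+th)\Big|_{t=0} =p!\sum_{i_1=1}^n\cdots\sum_{i_p=1}^n h_{i_pi_{p-1}}\cdots h_{i_2i_1}h_{i_1i_p}\,[\lambda_{i_1},\lambda_{i_2},\dots,\lambda_{i_p},\lambda_{i_p}]_{\exp}. \] Here $[x_0,\dots,x_m]_f$ denotes the divided difference of an entire function $f$ at $m+1$ not necessarily distinct points of $\mathbb{C}$ (so the ones above are of order $p+1$, that is, taken at $p+1$ points), given by $[x_0]_f=f(x_0)$ and $[x_0,x_1,\dots,x_m]_f=[x_1,\dots,x_m]_g$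 for $m\ge 1$, where $g(z)=\frac{f(z)-f(x_0)}{z-x_0}$ for $z\ne x_0$ and $g(x_0)=f'(x_0)$. -/

import Mathlib

/-- The divided difference `[x₀, x₁, …, xₘ]_f` of a function `f : ℂ → ℂ`, the points being given
as a list and not necessarily distinct. It is Newton's recursion
`[x]_f = f x`, `[x₀, x₁, …, xₘ]_f = [x₁, …, xₘ]_g`, where `g z = [x₀, z]_f` is
`(f z - f x₀) / (z - x₀)` for `z ≠ x₀` and is extended by the derivative `f' x₀` to `z = x₀`
(this `g` is Mathlib's `dslope f x₀`). The value at the empty list is a placeholder. -/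
noncomputable def dividedDifference : (ℂ → ℂ) → List ℂ → ℂ
  | _, [] => 0
  | f, [x] => f x
  | f, x :: y :: l => dividedDifference (dslope f x) (y :: l)

/-- `e` is a (complete) system of `n × n` matrix units in the ring `A`:
`e i j * e k l = δ j k • e i l` and `∑ i, e i i = 1`.
In an algebra with involution one often also asks for `star (e i j) = e j i`; this is not needed,
so both readings are covered. -/
structure IsMatrixUnits {n : ℕ} {A : Type*} [Ring A] (e : Fin n → Fin n → A) : Prop where
  mul_eq : ∀ i j k l, e i j * e k l = if j = k then e i l else 0
  sum_diag : ∑ i, e i i = 1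

/-! With `a k = 1 / k!`, expand `exp (x + t h) = ∑ a k • (x + t h) ^ k`. In the matrix units, the
part of `(x + h) ^ (p + m)` of degree `p` in `h` is a sum over index paths `j 0, …, j p`: the
entries of `h` along the path, times the complete homogeneous polynomial of degree `m` in the
eigenvalues met, times `e (j p) (j 0)` (`pow_eq_sum_pathSum`). The trace keeps only closed paths, so
one eigenvalue occurs twice. Summing over `m` with weights `a (p + m)` gives the divided difference,
since for an entire series these are `∑ a (m + length - 1) * (complete homogeneous of degree m)`
(`dividedDifference_eq_tsum`). Geometric bounds against the factorials justify regrouping by powers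
of `t`; the resulting series converges everywhere, so the function is smooth and its `p`-th
derivative at `0` is `p!` times the `p`-th coefficient. -/

/-! ### Entire power series and their rearrangement -/

theorem summable_norm_of_summable_powers {a : ℕ → ℂ} (ha : ∀ z : ℂ, Summable fun k => a k * z ^ k)
    (r : ℝ) : Summable fun k => ‖a k‖ * |r| ^ k := by
  simpa using (ha (r : ℂ)).norm

theorem summable_powers_shift {a : ℕ → ℂ} (ha : ∀ z : ℂ, Summable fun k => a k * z ^ k) (m : ℕ)
    (z : ℂ) : Summable fun k => a (k + m) * z ^ k := by
  rcases eq_or_ne z 0 with rfl | hz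
  · exact summable_of_ne_finset_zero (s := {0}) fun k hk => by
      rw [zero_pow (by simpa using hk), mul_zero]
  · have h := ((summable_nat_add_iff m).2 (ha z)).mul_right (z ^ m)⁻¹
    refine h.congr fun k => ?_
    rw [pow_add, mul_assoc, mul_assoc, mul_inv_cancel₀ (pow_ne_zero _ hz), mul_one]

/-- A family of geometric growth, weighted along the antidiagonals by the coefficients of an
entire function, is summable. -/
theorem summable_antidiagonal_weight {a : ℕ → ℂ} (ha : ∀ z : ℂ, Summable fun k => a k * z ^ k)
    {u : ℕ × ℕ → ℂ} {C K : ℝ} (hu : ∀ q, ‖u q‖ ≤ C * K ^ (q.1 + q.2)) :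
    Summable fun q : ℕ × ℕ => a (q.1 + q.2) * u q := by
  rw [← Finset.HasAntidiagonal.sigmaAntidiagonalEquivProd.summable_iff]
  refine Summable.of_norm ?_
  rw [summable_sigma_of_nonneg fun _ => norm_nonneg _]
  refine ⟨fun k => (hasSum_fintype _).summable, ?_⟩
  refine Summable.of_nonneg_of_le (fun k => tsum_nonneg fun _ => norm_nonneg _) (fun k => ?_)
    ((summable_norm_of_summable_powers ha (2 * K)).mul_left |C|)
  rw [tsum_fintype]
  calc _ ≤ ∑ _q : Finset.HasAntidiagonal.antidiagonal k, ‖a k‖ * (|C| * |K| ^ k) := by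
        refine Finset.sum_le_sum fun q _ => ?_
        have hq : q.1.1 + q.1.2 = k := Finset.HasAntidiagonal.mem_antidiagonal.1 q.2
        have h := (hu q.1).trans (le_abs_self _)
        rw [hq, abs_mul, abs_pow] at h
        change ‖a (q.1.1 + q.1.2) * u q.1‖ ≤ _
        rw [hq, norm_mul]
        gcongr
    _ = (k + 1 : ℝ) * (‖a k‖ * (|C| * |K| ^ k)) := by simp
    -- The `k + 1` pairs on an antidiagonal are absorbed by doubling the radius.
    _ ≤ 2 ^ k * (‖a k‖ * (|C| * |K| ^ k)) := by
        gcongr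
        exact_mod_cast Nat.lt_two_pow_self
    _ = _ := by rw [abs_mul, mul_pow, abs_two]; ring

theorem hasSum_antidiagonal_weight {a : ℕ → ℂ} {u : ℕ × ℕ → ℂ}
    (h : Summable fun q : ℕ × ℕ => a (q.1 + q.2) * u q) :
    HasSum (fun k => a k * ∑ q ∈ Finset.HasAntidiagonal.antidiagonal k, u q)
      (∑' i, ∑' j, a (i + j) * u (i, j)) := by
  rw [← h.tsum_prod]
  have h1 := (Finset.HasAntidiagonal.sigmaAntidiagonalEquivProd.hasSum_iff).2 h.hasSum
  refine h1.sigma fun k => ?_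
  convert hasSum_fintype _ using 1
  rw [Finset.mul_sum, ← Finset.sum_coe_sort]
  refine Finset.sum_congr rfl fun q _ => ?_
  change _ = a (q.1.1 + q.1.2) * u q.1
  rw [Finset.HasAntidiagonal.mem_antidiagonal.1 q.2]

/-- Stated over `RCLike` to serve both the complex variable of `dslope` and the real variable `t`.
-/
theorem hasFPowerSeriesOnBall_of_hasSum_pow_smul {𝕜 : Type*} [RCLike 𝕜] [NormedSpace 𝕜 ℂ]
    {f : 𝕜 → ℂ} {a : ℕ → ℂ} (h : ∀ z : 𝕜, HasSum (fun k => z ^ k • a k) (f z)) :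
    HasFPowerSeriesOnBall f (fun k => ContinuousMultilinearMap.mkPiRing 𝕜 (Fin k) (a k)) 0 ⊤ where
  r_le := by
    refine (FormalMultilinearSeries.radius_eq_top_of_summable_norm _ fun r => ?_).ge
    refine (h ((r : ℝ) : 𝕜)).summable.norm.congr fun k => ?_
    rw [ContinuousMultilinearMap.norm_mkPiRing, norm_smul, mul_comm]
    simp
  r_pos := by simp
  hasSum {y} _ := by simpa using h y

theorem contDiff_of_hasSum_pow_smul {𝕜 : Type*} [RCLike 𝕜] [NormedSpace 𝕜 ℂ]
    {f : 𝕜 → ℂ} {a : ℕ → ℂ} (h : ∀ z : 𝕜, HasSum (fun k => z ^ k • a k) (f z))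
    (n : WithTop ℕ∞) : ContDiff 𝕜 n f := by
  have h1 := (hasFPowerSeriesOnBall_of_hasSum_pow_smul h).analyticOnNhd
  rw [Metric.eball_top] at h1
  exact h1.contDiff

theorem iteratedDeriv_zero_of_hasSum_pow_smul {𝕜 : Type*} [RCLike 𝕜] [NormedSpace 𝕜 ℂ]
    {f : 𝕜 → ℂ} {a : ℕ → ℂ} (h : ∀ z : 𝕜, HasSum (fun k => z ^ k • a k) (f z)) (p : ℕ) :
    iteratedDeriv p f 0 = p.factorial * a p := by
  have h1 := (hasFPowerSeriesOnBall_of_hasSum_pow_smul h).factorial_smul 1 p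
  rw [iteratedDeriv_eq_iteratedFDeriv, ← h1]
  simp

/-! ### Difference quotients of entire functions -/

/-- The difference quotient of an entire function is the entire function whose coefficients are
the tails of the original series. -/
theorem hasSum_dslope {f : ℂ → ℂ} {a : ℕ → ℂ} (hf : ∀ z : ℂ, HasSum (fun k => a k * z ^ k) (f z))
    (x z : ℂ) :
    HasSum (fun j => (∑' i, a (i + j + 1) * x ^ i) * z ^ j) (dslope f x z) := by
  have ha : ∀ z : ℂ, Summable fun k => a k * z ^ k := fun z => (hf z).summable
  have hsum (z : ℂ) : Summable fun q : ℕ × ℕ => a (q.1 + q.2 + 1) * (z ^ q.1 * x ^ q.2) := by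
    refine summable_antidiagonal_weight (a := fun k => a (k + 1)) (C := 1) (K := max ‖z‖ ‖x‖)
      (summable_powers_shift ha 1) fun q => ?_
    rw [norm_mul, norm_pow, norm_pow, one_mul, pow_add]
    gcongr
    · exact le_max_left _ _
    · exact le_max_right _ _
  have hg (z : ℂ) : HasSum (fun j => (∑' i, a (i + j + 1) * x ^ i) * z ^ j)
      (∑' j, ∑' i, a (j + i + 1) * (z ^ j * x ^ i)) := by
    refine ((hsum z).prod.hasSum).congr_fun fun j => ?_
    rw [← tsum_mul_right]
    exact tsum_congr fun i => by rw [add_comm j i]; ring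
  suffices hfg : dslope f x = fun z => ∑' j, ∑' i, a (j + i + 1) * (z ^ j * x ^ i) by
    rw [hfg]; exact hg z
  have hfd : Differentiable ℂ f :=
    (contDiff_of_hasSum_pow_smul (a := a)
      (fun z => by simpa only [smul_eq_mul, mul_comm (z ^ _)] using hf z) 1).differentiable
      (by simp)
  -- Both sides are continuous, so it suffices to compare them off `z = x`, where `z ^ (k + 1) - x ^
  -- (k + 1)` factors as a geometric sum.
  refine Continuous.ext_on (dense_compl_singleton x) ?_ ?_ ?_
  · rw [← continuousOn_univ, continuousOn_dslope Filter.univ_mem]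
    exact ⟨hfd.continuous.continuousOn, hfd x⟩
  · have h0 := contDiff_of_hasSum_pow_smul (𝕜 := ℂ)
      (a := fun j => ∑' i, a (i + j + 1) * x ^ i)
      (f := fun z => ∑' j, ∑' i, a (j + i + 1) * (z ^ j * x ^ i))
      (fun z => by simpa only [smul_eq_mul, mul_comm (z ^ _)] using hg z) 0
    exact h0.continuous
  · intro z hz
    have hz' : z - x ≠ 0 := sub_ne_zero.2 hz
    rw [dslope_of_ne _ hz, slope_def_field]
    have h1 := hasSum_antidiagonal_weight (a := fun k => a (k + 1)) (hsum z)
    have h2 : HasSum (fun k => a (k + 1) * (z ^ (k + 1) - x ^ (k + 1))) (f z - f x) := by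
      have := (hf z).sub (hf x)
      rw [← hasSum_nat_add_iff' 1] at this
      simpa [mul_sub] using this
    refine (h2.div_const (z - x)).unique (h1.congr_fun fun k => ?_)
    rw [Finset.Nat.sum_antidiagonal_eq_sum_range_succ fun i j => z ^ i * x ^ j,
      div_eq_iff hz', mul_assoc]
    congr 1
    rw [← geom_sum₂_mul]
    simp

/-! ### Complete homogeneous polynomials and divided differences -/

/-- The generating series `∏ (1 - x X)⁻¹` of the complete homogeneous symmetric polynomials. -/
noncomputable def completeHomogeneousSeries (l : List ℂ) : PowerSeries ℂ :=
  (l.map fun x => PowerSeries.mk fun k => x ^ k).prod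

theorem completeHomogeneousSeries_cons (x : ℂ) (l : List ℂ) :
    completeHomogeneousSeries (x :: l) =
      (PowerSeries.mk fun k => x ^ k) * completeHomogeneousSeries l := by
  simp [completeHomogeneousSeries]

theorem completeHomogeneousSeries_perm {l l' : List ℂ} (h : l.Perm l') :
    completeHomogeneousSeries l = completeHomogeneousSeries l' :=
  (h.map _).prod_eq

theorem coeff_zero_completeHomogeneousSeries (l : List ℂ) :
    PowerSeries.coeff 0 (completeHomogeneousSeries l) = 1 := by
  induction l with
  | nil => simp [completeHomogeneousSeries]
  | cons x l ih =>
    rw [completeHomogeneousSeries_cons, PowerSeries.coeff_mul]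
    simpa using ih

theorem coeff_succ_completeHomogeneousSeries_cons (x : ℂ) (l : List ℂ) (m : ℕ) :
    PowerSeries.coeff (m + 1) (completeHomogeneousSeries (x :: l)) =
      x * PowerSeries.coeff m (completeHomogeneousSeries (x :: l)) +
        PowerSeries.coeff (m + 1) (completeHomogeneousSeries l) := by
  simp only [completeHomogeneousSeries_cons, PowerSeries.coeff_mul, PowerSeries.coeff_mk,
    Finset.Nat.sum_antidiagonal_succ, Finset.mul_sum, pow_zero, one_mul, pow_succ']
  rw [add_comm]
  simp only [mul_assoc]

/-- The recursion has two terms, each at most `R * (2 * R) ^ N`; the factor 2 in the base pays for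
both. -/
theorem norm_coeff_completeHomogeneousSeries_le {R : ℝ} (hR : 1 ≤ R) (l : List ℂ)
    (hl : ∀ x ∈ l, ‖x‖ ≤ R) (m : ℕ) :
    ‖PowerSeries.coeff m (completeHomogeneousSeries l)‖ ≤ (2 * R) ^ (l.length + m) := by
  have h2 : (1 : ℝ) ≤ 2 * R := by linarith
  induction l generalizing m with
  | nil =>
    cases m with
    | zero => simp [completeHomogeneousSeries]
    | succ m => simpa [completeHomogeneousSeries, PowerSeries.coeff_one] using by positivity
  | cons x l ih =>
    induction m with
    | zero =>
      rw [coeff_zero_completeHomogeneousSeries, norm_one]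
      exact one_le_pow₀ h2
    | succ m ihm =>
      rw [coeff_succ_completeHomogeneousSeries_cons]
      have h3 := ih (fun y hy => hl y (by simp [hy])) (m + 1)
      have hx := hl x (by simp)
      simp only [List.length_cons] at ihm ⊢
      calc _ ≤ R * (2 * R) ^ (l.length + 1 + m) + R * (2 * R) ^ (l.length + (m + 1)) := by
            refine (norm_add_le _ _).trans (add_le_add ?_ ?_)
            · rw [norm_mul]; gcongr
            · exact h3.trans (le_mul_of_one_le_left (by positivity) hR)
        _ = _ := by ring

/-- The divided differences of an entire function in terms of its Taylor coefficients and of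
complete homogeneous symmetric polynomials. -/
theorem dividedDifference_eq_tsum {f : ℂ → ℂ} {a : ℕ → ℂ}
    (hf : ∀ z : ℂ, HasSum (fun k => a k * z ^ k) (f z)) (x : ℂ) (l : List ℂ) :
    dividedDifference f (x :: l) =
      ∑' j, a (j + l.length) * PowerSeries.coeff j (completeHomogeneousSeries (x :: l)) := by
  induction l generalizing f a x with
  | nil =>
    simp [dividedDifference, completeHomogeneousSeries, (hf x).tsum_eq]
  | cons y l ih =>
    -- The induction hypothesis is applied to `dslope f x`, with coefficients `∑' i, a (i + j + 1) *
    -- x ^ i`; collecting `i + j` multiplies the generating series by the factor of `x`.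
    rw [dividedDifference, ih (hasSum_dslope hf x), completeHomogeneousSeries_cons x]
    have ha : ∀ z : ℂ, Summable fun k => a (k + (l.length + 1)) * z ^ k :=
      summable_powers_shift (fun z => (hf z).summable) _
    obtain ⟨R, hR1, hx, hR⟩ : ∃ R : ℝ, 1 ≤ R ∧ ‖x‖ ≤ R ∧ ∀ w ∈ y :: l, ‖w‖ ≤ R := by
      obtain ⟨M, hM⟩ := ((x :: y :: l).finite_toSet.image norm).bddAbove
      refine ⟨max 1 M, le_max_left _ _, (hM ⟨x, by simp, rfl⟩).trans (le_max_right _ _),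
        fun w hw => (hM ⟨w, by simp_all, rfl⟩).trans (le_max_right _ _)⟩
    have hs := summable_antidiagonal_weight ha (C := (2 * R) ^ (l.length + 1)) (K := 2 * R)
      (u := fun q => x ^ q.2 * PowerSeries.coeff q.1 (completeHomogeneousSeries (y :: l))) (by
        intro q
        have h1 := norm_coeff_completeHomogeneousSeries_le hR1 _ hR q.1
        rw [norm_mul, norm_pow]
        calc _ ≤ (2 * R) ^ q.2 * (2 * R) ^ (l.length + 1 + q.1) := by
              gcongr
              · linarith
              · simpa using h1
          _ = _ := by ring)
    have h := hasSum_antidiagonal_weight (a := fun k => a (k + (l.length + 1))) hs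
    rw [List.length_cons]
    calc _ = ∑' j, ∑' i, a (j + i + (l.length + 1)) *
          (x ^ i * PowerSeries.coeff j (completeHomogeneousSeries (y :: l))) := by
          refine tsum_congr fun j => ?_
          rw [← tsum_mul_right]
          refine tsum_congr fun i => ?_
          rw [mul_assoc]
          congr 2
          omega
      _ = _ := by
          rw [← h.tsum_eq]
          refine tsum_congr fun k => ?_
          rw [mul_comm (PowerSeries.mk _), PowerSeries.coeff_mul]
          simp [mul_comm]

/-! ### Expansion of powers along index paths -/

/-- The part of `(x + h) ^ (p + m)` of degree `p` in `h`, where `x = ∑ i, lam i • e i i` and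
`h = ∑ i, ∑ j, c i j • e i j`, as a sum over index paths of length `p`. -/
noncomputable def pathSum {n : ℕ} {A : Type*} [Ring A] [Algebra ℂ A] (e : Fin n → Fin n → A)
    (lam : Fin n → ℂ) (c : Fin n → Fin n → ℂ) (p m : ℕ) : A :=
  ∑ j : Fin (p + 1) → Fin n, ((∏ k : Fin p, c (j k.succ) (j k.castSucc)) *
    PowerSeries.coeff m (completeHomogeneousSeries (List.ofFn fun k => lam (j k)))) •
      e (j (Fin.last p)) (j 0)

section PathSum

variable {n : ℕ} {A : Type*} [Ring A] [Algebra ℂ A] {e : Fin n → Fin n → A}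

theorem IsMatrixUnits.mul_diagonal (he : IsMatrixUnits e) (lam : Fin n → ℂ) (a b : Fin n) :
    e a b * ∑ i, lam i • e i i = lam b • e a b := by
  simp [Finset.mul_sum, he.mul_eq]

theorem IsMatrixUnits.mul_combination (he : IsMatrixUnits e) (c : Fin n → Fin n → ℂ)
    (a b : Fin n) : e a b * ∑ i, ∑ j, c i j • e i j = ∑ d, c b d • e a d := by
  simp [Finset.mul_sum, he.mul_eq, Finset.sum_ite_irrel]

theorem pathSum_zero_zero (he : IsMatrixUnits e) (lam : Fin n → ℂ) (c : Fin n → Fin n → ℂ) :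
    pathSum e lam c 0 0 = 1 := by
  rw [pathSum, ← he.sum_diag]
  refine Fintype.sum_equiv (Equiv.funUnique (Fin 1) (Fin n)) _ _ fun j => ?_
  rw [coeff_zero_completeHomogeneousSeries]
  simp

/-- Right multiplication by `h` puts a new index at the start of the path; its eigenvalue does not
yet enter the coefficient, hence `k.succ`. -/
theorem pathSum_mul_combination (he : IsMatrixUnits e) (lam : Fin n → ℂ)
    (c : Fin n → Fin n → ℂ) (p m : ℕ) :
    pathSum e lam c p m * ∑ i, ∑ j, c i j • e i j =
      ∑ j : Fin (p + 2) → Fin n, ((∏ k : Fin (p + 1), c (j k.succ) (j k.castSucc)) *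
        PowerSeries.coeff m (completeHomogeneousSeries
          (List.ofFn fun k : Fin (p + 1) => lam (j k.succ)))) • e (j (Fin.last (p + 1))) (j 0) := by
  rw [pathSum, Finset.sum_mul]
  conv_rhs => rw [← (Fin.consEquiv fun _ => Fin n).sum_comp, Fintype.sum_prod_type, Finset.sum_comm]
  refine Finset.sum_congr rfl fun j _ => ?_
  rw [smul_mul_assoc, he.mul_combination, Finset.smul_sum]
  refine Finset.sum_congr rfl fun d _ => ?_
  simp only [Fin.consEquiv_apply, Fin.prod_univ_succ, Fin.cons_succ, Fin.castSucc_zero,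
    Fin.cons_zero, ← Fin.succ_castSucc, ← Fin.succ_last, smul_smul]
  congr 1
  ring

theorem pathSum_succ_zero (he : IsMatrixUnits e) (lam : Fin n → ℂ) (c : Fin n → Fin n → ℂ)
    (p : ℕ) : pathSum e lam c (p + 1) 0 = pathSum e lam c p 0 * ∑ i, ∑ j, c i j • e i j := by
  rw [pathSum_mul_combination he, pathSum]
  simp only [coeff_zero_completeHomogeneousSeries]

theorem pathSum_zero_succ (he : IsMatrixUnits e) (lam : Fin n → ℂ) (c : Fin n → Fin n → ℂ)
    (m : ℕ) : pathSum e lam c 0 (m + 1) = pathSum e lam c 0 m * ∑ i, lam i • e i i := by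
  rw [pathSum, pathSum, Finset.sum_mul]
  refine Finset.sum_congr rfl fun j _ => ?_
  rw [smul_mul_assoc, he.mul_diagonal, smul_smul]
  simp [completeHomogeneousSeries, pow_succ]

/-- Words in `x` and `h` are split by their last letter; this matches the recursion of the complete
homogeneous polynomials in the eigenvalue at `j 0`. -/
theorem pathSum_succ_succ (he : IsMatrixUnits e) (lam : Fin n → ℂ) (c : Fin n → Fin n → ℂ)
    (p m : ℕ) : pathSum e lam c (p + 1) (m + 1) =
      pathSum e lam c (p + 1) m * ∑ i, lam i • e i i +
        pathSum e lam c p (m + 1) * ∑ i, ∑ j, c i j • e i j := by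
  rw [pathSum_mul_combination he, pathSum, pathSum, Finset.sum_mul, ← Finset.sum_add_distrib]
  refine Finset.sum_congr rfl fun j _ => ?_
  rw [smul_mul_assoc, he.mul_diagonal, smul_smul, ← add_smul, List.ofFn_succ,
    coeff_succ_completeHomogeneousSeries_cons]
  congr 1
  ring

theorem pow_eq_sum_pathSum (he : IsMatrixUnits e) (lam : Fin n → ℂ) (c : Fin n → Fin n → ℂ)
    (t : ℂ) (k : ℕ) :
    (∑ i, lam i • e i i + t • ∑ i, ∑ j, c i j • e i j) ^ k =
      ∑ q ∈ Finset.HasAntidiagonal.antidiagonal k, t ^ q.1 • pathSum e lam c q.1 q.2 := by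
  induction k with
  | zero => simp [pathSum_zero_zero he]
  | succ k ih =>
    set x := ∑ i, lam i • e i i with hx
    set h := ∑ i, ∑ j, c i j • e i j with hh
    -- `P` collects the words ending in `x`, `Q` those ending in `h`; each is zero where no such
    -- word exists.
    let P : ℕ × ℕ → A := fun q => match q with
      | (_, 0) => 0
      | (p, m + 1) => t ^ p • (pathSum e lam c p m * x)
    let Q : ℕ × ℕ → A := fun q => match q with
      | (0, _) => 0
      | (p + 1, m) => t ^ (p + 1) • (pathSum e lam c p m * h)
    have hPQ : ∀ q ∈ Finset.HasAntidiagonal.antidiagonal (k + 1),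
        t ^ q.1 • pathSum e lam c q.1 q.2 = P q + Q q := by
      rintro ⟨_ | p, _ | m⟩ hq
      · simp at hq
      · simp [P, Q, pathSum_zero_succ he, hx]
      · simp [P, Q, pathSum_succ_zero he, hh]
      · simp [P, Q, pathSum_succ_succ he, hx, hh, smul_add]
    rw [Finset.sum_congr rfl hPQ, Finset.sum_add_distrib, Finset.Nat.sum_antidiagonal_succ',
      Finset.Nat.sum_antidiagonal_succ (f := Q), pow_succ, ih, mul_add, Finset.sum_mul,
      Finset.sum_mul]
    simp [P, Q, pow_succ', smul_smul]

end PathSum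

/-! ### Traces, norm bounds and the exponential -/

theorem IsMatrixUnits.trace_eq {H : Type*} [AddCommGroup H] [Module ℂ H]
    [FiniteDimensional ℂ H] {n : ℕ}
    (hn : Module.finrank ℂ H = n) {e : Fin n → Fin n → Module.End ℂ H} (he : IsMatrixUnits e)
    (a b : Fin n) : LinearMap.trace ℂ H (e a b) = if a = b then 1 else 0 := by
  -- The `n` diagonal units have equal traces with sum `finrank ℂ H = n`, so each has trace 1.
  have hdiag (i j : Fin n) : LinearMap.trace ℂ H (e i i) = LinearMap.trace ℂ H (e j j) := by
    have h1 : e i i = e i j * e j i := by simp [he.mul_eq]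
    have h2 : e j j = e j i * e i j := by simp [he.mul_eq]
    rw [h1, LinearMap.trace_mul_comm, ← h2]
  split_ifs with hab
  · subst hab
    have h := congrArg (LinearMap.trace ℂ H) he.sum_diag
    rw [map_sum, Finset.sum_congr rfl fun i _ => hdiag i a, LinearMap.trace_one, hn] at h
    have hn0 : (n : ℂ) ≠ 0 := Nat.cast_ne_zero.2 (Nat.pos_of_ne_zero fun h0 => by
      subst h0; exact a.elim0).ne'
    simpa [hn0] using h
  · have h1 : e a b = e a b * e b b := by simp [he.mul_eq]
    rw [h1, LinearMap.trace_mul_comm, he.mul_eq, if_neg (Ne.symm hab), map_zero]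

theorem norm_pathSum_le {n : ℕ} {A : Type*} [NormedRing A] [NormedAlgebra ℂ A]
    {e : Fin n → Fin n → A} (he : IsMatrixUnits e) (lam : Fin n → ℂ) (c : Fin n → Fin n → ℂ)
    {K : ℝ} (hx : ‖∑ i, lam i • e i i‖ ≤ K) (hh : ‖∑ i, ∑ j, c i j • e i j‖ ≤ K) (p m : ℕ) :
    ‖pathSum e lam c p m‖ ≤ ‖(1 : A)‖ * (2 * K) ^ (p + m) := by
  have hK : 0 ≤ K := (norm_nonneg _).trans hx
  have step {a b : A} {r : ℝ} {k : ℕ} (ha : ‖a‖ ≤ r * (2 * K) ^ k) (hb : ‖b‖ ≤ K) :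
      ‖a * b‖ ≤ r * (2 * K) ^ k * K :=
    (norm_mul_le _ _).trans (mul_le_mul ha hb (norm_nonneg _) ((norm_nonneg _).trans ha))
  have weaken (k : ℕ) : ‖(1 : A)‖ * (2 * K) ^ k * K ≤ ‖(1 : A)‖ * (2 * K) ^ (k + 1) := by
    rw [pow_succ, ← mul_assoc]
    gcongr
    linarith
  induction p generalizing m with
  | zero =>
    induction m with
    | zero => simp [pathSum_zero_zero he]
    | succ m ihm =>
      rw [pathSum_zero_succ he]
      exact (step ihm hx).trans (weaken _)
  | succ p ih =>
    induction m with
    | zero =>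
      rw [pathSum_succ_zero he]
      exact (step (ih 0) hh).trans (weaken _)
    | succ m ihm =>
      rw [pathSum_succ_succ he]
      refine (norm_add_le _ _).trans ((add_le_add (step ihm hx) (step (ih (m + 1)) hh)).trans ?_)
      rw [show p + (m + 1) = p + 1 + m by omega, show p + 1 + (m + 1) = p + 1 + m + 1 by omega,
        pow_succ]
      apply le_of_eq
      ring

theorem IsMatrixUnits.trace_pathSum_succ {H : Type*} [AddCommGroup H] [Module ℂ H]
    [FiniteDimensional ℂ H] {n : ℕ}
    (hn : Module.finrank ℂ H = n) {e : Fin n → Fin n → Module.End ℂ H} (he : IsMatrixUnits e)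
    (lam : Fin n → ℂ) (c : Fin n → Fin n → ℂ) (p m : ℕ) :
    LinearMap.trace ℂ H (pathSum e lam c (p + 1) m) =
      ∑ i : Fin (p + 1) → Fin n,
        ((∏ k : Fin p, c (i k.succ) (i k.castSucc)) * c (i 0) (i (Fin.last p))) *
          PowerSeries.coeff m (completeHomogeneousSeries
            (List.ofFn (fun k => lam (i k)) ++ [lam (i (Fin.last p))])) := by
  rw [pathSum, map_sum, ← (Fin.consEquiv fun _ => Fin n).sum_comp, Fintype.sum_prod_type,
    Finset.sum_comm]
  refine Finset.sum_congr rfl fun i _ => ?_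
  simp only [map_smul, he.trace_eq hn, Fin.consEquiv_apply, Fin.prod_univ_succ, Fin.cons_succ,
    Fin.castSucc_zero, Fin.cons_zero, ← Fin.succ_castSucc, ← Fin.succ_last, List.ofFn_succ,
    smul_eq_mul, mul_ite, mul_one, mul_zero]
  -- Only closed paths survive; the repeated eigenvalue is then moved from the head of the list to
  -- its end by symmetry.
  rw [Finset.sum_ite_eq, if_pos (Finset.mem_univ _), mul_comm (c _ _)]
  rw [completeHomogeneousSeries_perm (List.perm_append_singleton _ _)]

theorem hasSum_exp_coeff (z : ℂ) :
    HasSum (fun k => (k.factorial : ℂ)⁻¹ * z ^ k) (Complex.exp z) := by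
  rw [Complex.exp_eq_exp_ℂ]
  exact NormedSpace.exp_series_hasSum_exp' (𝕂 := ℂ) z

theorem hasSum_trace_exp {H : Type*} [NormedAddCommGroup H] [InnerProductSpace ℂ H]
    [FiniteDimensional ℂ H] {n : ℕ} {e : Fin n → Fin n → (H →L[ℂ] H)} (he : IsMatrixUnits e)
    (lam : Fin n → ℂ) (c : Fin n → Fin n → ℂ) (t : ℂ) :
    HasSum (fun p => t ^ p * ∑' m, ((p + m).factorial : ℂ)⁻¹ *
        LinearMap.trace ℂ H (pathSum e lam c p m : H →L[ℂ] H))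
      (LinearMap.trace ℂ H
        (NormedSpace.exp (∑ i, lam i • e i i + t • ∑ i, ∑ j, c i j • e i j) : H →L[ℂ] H)) := by
  have : CompleteSpace H := FiniteDimensional.complete ℂ H
  let T : (H →L[ℂ] H) →L[ℂ] ℂ := LinearMap.toContinuousLinearMap
    (LinearMap.trace ℂ H ∘ₗ ContinuousLinearMap.coeLM ℂ)
  have hT (y : H →L[ℂ] H) : LinearMap.trace ℂ H (y : H →L[ℂ] H) = T y := rfl
  simp only [hT]
  set x := ∑ i, lam i • e i i with hx
  set h := ∑ i, ∑ j, c i j • e i j with hh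
  have hsum : Summable fun q : ℕ × ℕ =>
      ((q.1 + q.2).factorial : ℂ)⁻¹ * (t ^ q.1 * T (pathSum e lam c q.1 q.2)) := by
    refine summable_antidiagonal_weight (a := fun k => (k.factorial : ℂ)⁻¹)
      (C := ‖T‖ * ‖(1 : H →L[ℂ] H)‖) (K := max 1 ‖t‖ * (2 * max ‖x‖ ‖h‖))
      (fun z => (hasSum_exp_coeff z).summable) fun q => ?_
    have h1 := norm_pathSum_le he lam c (le_max_left ‖x‖ ‖h‖) (le_max_right ‖x‖ ‖h‖) q.1 q.2
    rw [norm_mul, norm_pow, mul_pow]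
    -- The `max` with 1 lets the exponent grow from `q.1` to `q.1 + q.2`.
    have h2 : ‖t‖ ^ q.1 ≤ max 1 ‖t‖ ^ (q.1 + q.2) :=
      (pow_le_pow_left₀ (norm_nonneg _) (le_max_right _ _) _).trans
        (pow_le_pow_right₀ (le_max_left _ _) (Nat.le_add_right _ _))
    calc _ ≤ max 1 ‖t‖ ^ (q.1 + q.2) *
          (‖T‖ * (‖(1 : H →L[ℂ] H)‖ * (2 * max ‖x‖ ‖h‖) ^ (q.1 + q.2))) :=
        mul_le_mul h2 ((T.le_opNorm _).trans (by gcongr)) (norm_nonneg _) (by positivity)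
      _ = _ := by ring
  have hexp : HasSum (fun k => (k.factorial : ℂ)⁻¹ * T ((x + t • h) ^ k))
      (T (NormedSpace.exp (x + t • h))) := by
    have := (NormedSpace.exp_series_hasSum_exp' (𝕂 := ℂ) (x + t • h)).mapL T
    simpa only [map_smul, smul_eq_mul] using this
  have hval : T (NormedSpace.exp (x + t • h)) = ∑' p, ∑' m,
      ((p + m).factorial : ℂ)⁻¹ * (t ^ p * T (pathSum e lam c p m)) := by
    refine hexp.unique ((hasSum_antidiagonal_weight (a := fun k => (k.factorial : ℂ)⁻¹)
      hsum).congr_fun fun k => ?_)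
    rw [hx, hh, pow_eq_sum_pathSum he, map_sum]
    simp only [map_smul, smul_eq_mul]
  rw [hval]
  refine hsum.prod.hasSum.congr_fun fun p => ?_
  rw [← tsum_mul_left]
  exact tsum_congr fun m => by ring

theorem pathSum_coe {H : Type*} [NormedAddCommGroup H] [NormedSpace ℂ H] {n : ℕ}
    (e : Fin n → Fin n → (H →L[ℂ] H)) (lam : Fin n → ℂ) (c : Fin n → Fin n → ℂ) (p m : ℕ) :
    ((pathSum e lam c p m : H →L[ℂ] H) : H →ₗ[ℂ] H) =
      pathSum (A := Module.End ℂ H) (fun i j => (e i j : H →ₗ[ℂ] H)) lam c p m := by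
  ext v
  simp [pathSum]

theorem IsMatrixUnits.coe {H : Type*} [NormedAddCommGroup H] [NormedSpace ℂ H] {n : ℕ}
    {e : Fin n → Fin n → (H →L[ℂ] H)} (he : IsMatrixUnits e) :
    IsMatrixUnits (A := Module.End ℂ H) fun i j => (e i j : H →ₗ[ℂ] H) where
  mul_eq i j k l := by
    have h := congrArg (fun y : H →L[ℂ] H => (y : H →ₗ[ℂ] H)) (he.mul_eq i j k l)
    refine Eq.trans h ?_
    split_ifs <;> rfl
  sum_diag := by
    have h := congrArg (fun y : H →L[ℂ] H => (y : H →ₗ[ℂ] H)) he.sum_diag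
    ext v
    simpa using LinearMap.congr_fun h v

theorem tsum_trace_pathSum {H : Type*} [NormedAddCommGroup H] [InnerProductSpace ℂ H]
    [FiniteDimensional ℂ H] {n : ℕ} (hn : Module.finrank ℂ H = n)
    {e : Fin n → Fin n → (H →L[ℂ] H)} (he : IsMatrixUnits e)
    (lam : Fin n → ℂ) (c : Fin n → Fin n → ℂ) (p : ℕ) :
    ∑' m, ((p + 1 + m).factorial : ℂ)⁻¹ *
        LinearMap.trace ℂ H (pathSum e lam c (p + 1) m : H →L[ℂ] H) =
      ∑ i : Fin (p + 1) → Fin n,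
        ((∏ k : Fin p, c (i k.succ) (i k.castSucc)) * c (i 0) (i (Fin.last p))) *
          dividedDifference Complex.exp
            (List.ofFn (fun k => lam (i k)) ++ [lam (i (Fin.last p))]) := by
  simp only [pathSum_coe, he.coe.trace_pathSum_succ hn, Finset.mul_sum,
    mul_left_comm (Nat.cast _)⁻¹]
  have hs (l : List ℂ) : Summable fun m => ((p + 1 + m).factorial : ℂ)⁻¹ *
      PowerSeries.coeff m (completeHomogeneousSeries l) := by
    obtain ⟨M, hM⟩ := (l.finite_toSet.image norm).bddAbove
    have h1 := norm_coeff_completeHomogeneousSeries_le (le_max_left 1 M) l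
      fun w hw => (hM ⟨w, hw, rfl⟩).trans (le_max_right _ _)
    have h2 := summable_norm_of_summable_powers (summable_powers_shift
      (fun z => (hasSum_exp_coeff z).summable) (p + 1)) (2 * max 1 M)
    refine Summable.of_norm_bounded (h2.mul_left ((2 * max 1 M) ^ l.length)) fun m => ?_
    have hpos : 0 ≤ 2 * max 1 M := by positivity
    rw [norm_mul, abs_of_nonneg hpos, add_comm (p + 1)]
    calc _ ≤ ‖((m + (p + 1)).factorial : ℂ)⁻¹‖ * (2 * max 1 M) ^ (l.length + m) := by
          gcongr
          exact h1 m
      _ = _ := by ring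
  rw [Summable.tsum_finsetSum fun i _ => (hs _).mul_left _]
  refine Finset.sum_congr rfl fun i _ => ?_
  rw [tsum_mul_left, List.ofFn_succ, List.cons_append, dividedDifference_eq_tsum hasSum_exp_coeff]
  congr 1
  refine tsum_congr fun m => ?_
  simp [add_comm m]

theorem mainTheorem3 {H : Type*} [NormedAddCommGroup H] [InnerProductSpace ℂ H]
    [FiniteDimensional ℂ H] (n : ℕ) (hn : Module.finrank ℂ H = n)
    (e : Fin n → Fin n → (H →L[ℂ] H)) (he : IsMatrixUnits e)
    (lam : Fin n → ℂ) (c : Fin n → Fin n → ℂ) (x h : H →L[ℂ] H)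
    (hx : x = ∑ i, lam i • e i i) (hh : h = ∑ i, ∑ j, c i j • e i j)
    (p : ℕ) (hp : 1 ≤ p) :
    ContDiff ℝ ((⊤ : ℕ∞) : WithTop ℕ∞)
      (fun t : ℝ => LinearMap.trace ℂ H (NormedSpace.exp (x + (t : ℂ) • h) : H →L[ℂ] H)) ∧
    iteratedDeriv p
      (fun t : ℝ => LinearMap.trace ℂ H (NormedSpace.exp (x + (t : ℂ) • h) : H →L[ℂ] H)) 0 =
      (p.factorial : ℂ) * ∑ i : Fin p → Fin n,
        ((∏ k : Fin (p - 1), c (i ⟨(k : ℕ) + 1, by omega⟩) (i ⟨(k : ℕ), by omega⟩)) *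
            c (i ⟨0, by omega⟩) (i ⟨p - 1, by omega⟩)) *
          dividedDifference Complex.exp
            (List.ofFn (fun k : Fin p => lam (i k)) ++ [lam (i ⟨p - 1, by omega⟩)]) := by
  have hsum (t : ℝ) : HasSum (fun q => t ^ q • ∑' m, ((q + m).factorial : ℂ)⁻¹ *
        LinearMap.trace ℂ H (pathSum e lam c q m : H →L[ℂ] H))
      (LinearMap.trace ℂ H (NormedSpace.exp (x + (t : ℂ) • h) : H →L[ℂ] H)) := by
    rw [hx, hh]
    simpa only [Complex.real_smul, Complex.ofReal_pow] using hasSum_trace_exp he lam c (t : ℂ)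
  refine ⟨contDiff_of_hasSum_pow_smul hsum _, ?_⟩
  rw [iteratedDeriv_zero_of_hasSum_pow_smul hsum]
  obtain ⟨p, rfl⟩ := Nat.exists_eq_add_of_le' hp
  rw [tsum_trace_pathSum hn he]
  rfl
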